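/- Let $\mathcal X\subseteq\mathbb R^n$ be a state space and $\mathcal U\subseteq\mathbb R^m$ an input space, and consider the uncertain control-affine system $$\dot x=\hat f(x)+\hat g(x)u+A(x)u+b(x),\qquad x\in\mathcal X,\ u\in\mathcal U,\tag{S}$$ with nominal model $\dot x=\hat f(x)+\hat g(x)u$. A function $\alpha:[0,\infty)\to[0,\infty)$ is of class $\mathcal K_\infty$ if it is continuous, strictly increasing and unbounded with $\alpha(0)=0$; a continuous $\beta:[0,\infty)^2\to[0,\infty)$ is of class $\mathcal{KL}_\infty$ if $\beta(\cdot,s)\in\mathcal K_\infty$ for every $s$ and $\beta(r,\cdot)$ is nonincreasing with limit $0$ for every $r$. Let $\mathcal C\subseteq\mathcal X$ with $0\in\mathcal C$, and let the continuously differentiable function $V:\mathcal X\to[0,\infty)$ be a control Lyapunov function on $\mathcal C$ for the nominal model: there are $\underline\alpha,\overline\alpha,\alpha\in\mathcal K_\infty$ with $$\underline\alpha(\|x\|)\le V(x)\le\overline\alpha(\|x\|),\qquad \inf_{u\in\mathcal U}(\hat f(x)+\hat g(x)u)^\top\nabla V(x)\le-\alpha(\|x\|)\qquad(x\in\mathcal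 C).$$ Given estimators $\hat a:\mathcal X\to\mathbb R^m$, $\hat b:\mathcal X\to\mathbb R$ (possibly $\hat a=0$, $\hat b=0$), put $$\hat{\dot V}(x,u)=(\hat f(x)+\hat g(x)u)^\top\nabla V(x)+\hat a(x)^\top u+\hat b(x),$$ $$a_V(x)=A(x)^\top\nabla V(x)-\hat a(x),\qquad b_V(x)=b(x)^\top\nabla V(x)-\hat b(x),$$ so that along (S) $\dot V=\hat{\dot V}(x,u)+\delta$ with projected disturbance $\delta=a_V(x)^\top u+b_V(x)$. Assume that $\inf_{u\in\mathcal U}\hat{\dot V}(x,u)\le-\alpha(\|x\|)$ for all $x\in\mathcal C$. Let $\Delta$ assign to every $x\in\mathcal X$ a bounded set $\Delta(x)\subseteq\mathbb R^m\times\mathbb R$ with $(a_V(x),b_V(x))\in\Delta(x)$, and let $k:\mathcal X\to\mathcal U$ be a state feedback with $\hat{\dot V}(x,k(x))\le-\alpha(\|x\|)$ for all $x\in\mathcal C$. Suppose that there are $\alpha_p,\alpha_q\in\mathcal K_\infty$ with $\alpha_p+\alpha_q=\alpha$ and a sublevel set $\Omega=\{x\in\mathcal X:V(x)\le c\}$,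 $c>0$, with $\Omega\subseteq\mathcal C$ and $$\|x\|\ge\sup_{(a,b)\in\Delta(x)}\alpha_q^{-1}\bigl(a^\top k(x)+b\bigr)\qquad\text{for all }x\in\partial\Omega,$$ where $\partial\Omega$ is the boundary of $\Omega$ in $\mathcal X$ and $\alpha_q^{-1}(r)=0$ for $r<0$. Then, for the system (S) with $u=k(x)$: 1. $\Omega$ is forward invariant: every (classical, $\mathcal X$-valued) solution on an interval $[0,T)$, $0<T\le\infty$, with $x(0)\in\Omega$ satisfies $x(t)\in\Omega$ for all $t\in[0,T)$. 2. The system is projection to state stable with respect to the projection $V$ on $\Omega$: $V$ is a dynamic projection on $\Omega$, i.e. it is continuously differentiable and bounded below and above by class $\mathcal K_\infty$ functions of $\|x\|$ there, and there are $\beta\in\mathcal{KL}_\infty$ and $\gamma\in\mathcal K_\infty$ such that every such solution with $x(0)\in\Omega$ along which $\delta(\tau)=a_V(x(\tau))^\top k(x(\tau))+b_V(x(\tau))$ is bounded satisfies $$\|x(t)\|\le\beta(\|x(0)\|,t)+\gamma\Bigl(\sup_{0\le\tau<T}|\delta(\tau)|\Bigr)\qquad\text{for all }t\in[0,T).$$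 -/

import Mathlib

open scoped NNReal ENNReal Topology RealInnerProductSpace

noncomputable section

namespace PSS

/-! ### Comparison functions -/

/-- Class `K∞`: continuous, strictly increasing, zero at zero and unbounded on `[0, ∞)`. -/
structure ClassKInfty (α : ℝ≥0 → ℝ≥0) : Prop where
  continuous : Continuous α
  strictMono : StrictMono α
  map_zero : α 0 = 0
  tendsto : Filter.Tendsto α Filter.atTop Filter.atTop

/-- Class `KL∞`: jointly continuous, class `K∞` in the first variable, and nonincreasing with
limit `0` in the second variable. -/
structure ClassKLInfty (β : ℝ≥0 → ℝ≥0 → ℝ≥0) : Prop where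
  continuous : Continuous (Function.uncurry β)
  classKInfty : ∀ s, ClassKInfty fun r => β r s
  antitone : ∀ r, Antitone (β r)
  tendsto : ∀ r, Filter.Tendsto (β r) Filter.atTop (𝓝 0)

/-- The inverse `α⁻¹` of a class `K∞` function (a bijection of `[0, ∞)`), as a function of a real
argument. Negative arguments, which lie outside the range of `α`, are sent to `0 = α⁻¹ 0`, so that
`α⁻¹ r ≤ s` says `r ≤ α s` for every real `r`. -/
def kInv (α : ℝ≥0 → ℝ≥0) (r : ℝ) : ℝ≥0 := Function.invFun α r.toNNReal

/-! ### Solutions, invariance, projection to state stability -/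

/-- The time interval `[0, T)`, where `T ≤ ∞`. -/
def timeInterval (T : EReal) : Set ℝ := {t | 0 ≤ t ∧ (t : EReal) < T}

section Systems

variable {E I Y : Type*} [NormedAddCommGroup E] [NormedSpace ℝ E]
  [NormedAddCommGroup Y] [NormedSpace ℝ Y]

/-- `x` is a (classical) solution of `ẋ = F(x)` on `[0, T)` with values in the state space `X`. -/
def IsSolution (X : Set E) (F : E → E) (T : EReal) (x : ℝ → E) : Prop :=
  ∀ t ∈ timeInterval T, x t ∈ X ∧ HasDerivWithinAt x (F (x t)) (timeInterval T) t

/-- `Ω` is forward invariant for `ẋ = f(x, u)` under the state feedback `u = k(x)`. -/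
def ForwardInvariant (X : Set E) (f : E → I → E) (k : E → I) (Ω : Set E) : Prop :=
  ∀ (T : EReal) (x : ℝ → E), IsSolution X (fun z => f z (k z)) T x → x 0 ∈ Ω →
    ∀ t ∈ timeInterval T, x t ∈ Ω

/-- `Π` is a dynamic projection on `Ω`: continuously differentiable (on a neighbourhood of each
point of `Ω`), with `σlo(‖x‖) ≤ ‖Π(x)‖ ≤ σup(‖x‖)` for class `K∞` functions `σlo`, `σup`. -/
def IsDynamicProjectionOn (P : E → Y) (Ω : Set E) : Prop :=
  (∀ x ∈ Ω, ContDiffAt ℝ 1 P x) ∧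
    ∃ σlo σup : ℝ≥0 → ℝ≥0, ClassKInfty σlo ∧ ClassKInfty σup ∧
      ∀ x ∈ Ω, σlo ‖x‖₊ ≤ ‖P x‖₊ ∧ ‖P x‖₊ ≤ σup ‖x‖₊

/-- The projected disturbance `δ` of `y = Π(x)`, defined by `ẏ = h(x, u) + δ`, where `h` is the
model of the projected dynamics and `ẏ = DΠ(x) f(x, u)` along `ẋ = f(x, u)`. If `h` comes from an
undisturbed model `f₀`, `h(x, u) = DΠ(x) f₀(x, u)`, then `δ = DΠ(x) (f(x, u) - f₀(x, u))`. -/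
def projDisturbance (P : E → Y) (f : E → I → E) (h : E → I → Y) (x : E) (u : I) : Y :=
  fderiv ℝ P x (f x u) - h x u

/-- Projection to state stability on `Ω` of `ẋ = f(x, u)` under the state feedback `u = k(x)`, with
respect to the dynamic projection `Π`, with projected dynamics `ẏ = h(x, u) + δ`: there are
`β` of class `KL∞` and `γ` of class `K∞` with `‖x(t)‖ ≤ β(‖x(0)‖, t) + γ(sup_τ ‖δ(τ)‖)` at all
times, for every solution that starts in `Ω` and has a bounded projected disturbance. -/
def IsPSSOn (X : Set E) (f : E → I → E) (k : E → I) (P : E → Y) (h : E → I → Y)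
    (Ω : Set E) : Prop :=
  IsDynamicProjectionOn P Ω ∧
    ∃ (β : ℝ≥0 → ℝ≥0 → ℝ≥0) (γ : ℝ≥0 → ℝ≥0), ClassKLInfty β ∧ ClassKInfty γ ∧
      ∀ (T : EReal) (x : ℝ → E), IsSolution X (fun z => f z (k z)) T x → x 0 ∈ Ω →
        BddAbove (Set.range fun τ : timeInterval T =>
          ‖projDisturbance P f h (x τ) (k (x τ))‖₊) →
        ∀ t ∈ timeInterval T,
          ‖x t‖₊ ≤ β ‖x 0‖₊ t.toNNReal +
            γ (⨆ τ : timeInterval T, ‖projDisturbance P f h (x τ) (k (x τ))‖₊)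

end Systems

/-- The sublevel set `{x ∈ X : V(x) ≤ c}` of a function `V` on `X`. -/
def sublevel {E : Type*} (X : Set E) (V : E → ℝ) (c : ℝ) : Set E := {x ∈ X | V x ≤ c}

/-- The boundary of `Ω` in the state space `X`. -/
def relBoundary {E : Type*} [TopologicalSpace E] (X Ω : Set E) : Set E :=
  X ∩ closure Ω ∩ closure (X \ Ω)

/-! ### Affine control systems -/

section Affine

variable {n m : ℕ}

/-- The nominal model `f̂(x) + ĝ(x) u`. -/
def nominalDyn (fhat : EuclideanSpace ℝ (Fin n) → EuclideanSpace ℝ (Fin n))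
    (ghat : EuclideanSpace ℝ (Fin n) → EuclideanSpace ℝ (Fin m) →L[ℝ] EuclideanSpace ℝ (Fin n))
    (x : EuclideanSpace ℝ (Fin n)) (u : EuclideanSpace ℝ (Fin m)) : EuclideanSpace ℝ (Fin n) :=
  fhat x + ghat x u

/-- The uncertain system `f̂(x) + ĝ(x) u + (A(x) u + b(x))`. -/
def uncertainDyn (fhat : EuclideanSpace ℝ (Fin n) → EuclideanSpace ℝ (Fin n))
    (ghat : EuclideanSpace ℝ (Fin n) → EuclideanSpace ℝ (Fin m) →L[ℝ] EuclideanSpace ℝ (Fin n))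
    (A : EuclideanSpace ℝ (Fin n) → EuclideanSpace ℝ (Fin m) →L[ℝ] EuclideanSpace ℝ (Fin n))
    (b : EuclideanSpace ℝ (Fin n) → EuclideanSpace ℝ (Fin n))
    (x : EuclideanSpace ℝ (Fin n)) (u : EuclideanSpace ℝ (Fin m)) : EuclideanSpace ℝ (Fin n) :=
  nominalDyn fhat ghat x u + (A x u + b x)

/-- `V : X → [0, ∞)` is continuously differentiable and is a control Lyapunov function on `C ⊆ X`,
with the class `K∞` functions `αlo`, `αup`, `α`, for `ẋ = f(x, u)` with inputs in `U`. The infimum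
over the inputs is taken in the extended reals. -/
structure IsCLFOn (X C : Set (EuclideanSpace ℝ (Fin n))) (U : Set (EuclideanSpace ℝ (Fin m)))
    (f : EuclideanSpace ℝ (Fin n) → EuclideanSpace ℝ (Fin m) → EuclideanSpace ℝ (Fin n))
    (V : EuclideanSpace ℝ (Fin n) → ℝ) (αlo αup α : ℝ≥0 → ℝ≥0) : Prop where
  contDiff : ∀ x ∈ X, ContDiffAt ℝ 1 V x
  nonneg : ∀ x ∈ X, 0 ≤ V x
  lo_classKInfty : ClassKInfty αlo
  up_classKInfty : ClassKInfty αup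
  classKInfty : ClassKInfty α
  le : ∀ x ∈ C, (αlo ‖x‖₊ : ℝ) ≤ V x ∧ V x ≤ αup ‖x‖₊
  decrease : ∀ x ∈ C,
    (⨅ u ∈ U, ((⟪f x u, gradient V x⟫ : ℝ) : EReal)) ≤ ((-(α ‖x‖₊ : ℝ) : ℝ) : EReal)

/-- The estimated derivative `(f̂(x) + ĝ(x) u)ᵀ ∇V(x) + â(x)ᵀ u + b̂(x)` of `V`. -/
def estDeriv (fhat : EuclideanSpace ℝ (Fin n) → EuclideanSpace ℝ (Fin n))
    (ghat : EuclideanSpace ℝ (Fin n) → EuclideanSpace ℝ (Fin m) →L[ℝ] EuclideanSpace ℝ (Fin n))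
    (V : EuclideanSpace ℝ (Fin n) → ℝ)
    (ahat : EuclideanSpace ℝ (Fin n) → EuclideanSpace ℝ (Fin m))
    (bhat : EuclideanSpace ℝ (Fin n) → ℝ)
    (x : EuclideanSpace ℝ (Fin n)) (u : EuclideanSpace ℝ (Fin m)) : ℝ :=
  ⟪nominalDyn fhat ghat x u, gradient V x⟫ + ⟪ahat x, u⟫ + bhat x

/-- The residual `a(x) = A(x)ᵀ ∇V(x) - â(x)`. -/
def residualA (A : EuclideanSpace ℝ (Fin n) → EuclideanSpace ℝ (Fin m) →L[ℝ]
      EuclideanSpace ℝ (Fin n))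
    (V : EuclideanSpace ℝ (Fin n) → ℝ)
    (ahat : EuclideanSpace ℝ (Fin n) → EuclideanSpace ℝ (Fin m))
    (x : EuclideanSpace ℝ (Fin n)) : EuclideanSpace ℝ (Fin m) :=
  ContinuousLinearMap.adjoint (A x) (gradient V x) - ahat x

/-- The residual `b(x)ᵀ ∇V(x) - b̂(x)`. -/
def residualB (b : EuclideanSpace ℝ (Fin n) → EuclideanSpace ℝ (Fin n))
    (V : EuclideanSpace ℝ (Fin n) → ℝ) (bhat : EuclideanSpace ℝ (Fin n) → ℝ)
    (x : EuclideanSpace ℝ (Fin n)) : ℝ :=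
  ⟪b x, gradient V x⟫ - bhat x

/-- `Δ` is an uncertainty function on `X` for the residuals `a` and `b`. -/
def IsUncertaintyFunction (X : Set (EuclideanSpace ℝ (Fin n)))
    (a : EuclideanSpace ℝ (Fin n) → EuclideanSpace ℝ (Fin m)) (b : EuclideanSpace ℝ (Fin n) → ℝ)
    (Δ : EuclideanSpace ℝ (Fin n) → Set (EuclideanSpace ℝ (Fin m) × ℝ)) : Prop :=
  ∀ x ∈ X, Bornology.IsBounded (Δ x) ∧ (a x, b x) ∈ Δ x

/-- The admissible inputs `{u ∈ U : h(x, u) ≤ -α(‖x‖)}`, where `h` is the estimated derivative. -/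
def admissibleInputs (U : Set (EuclideanSpace ℝ (Fin m)))
    (h : EuclideanSpace ℝ (Fin n) → EuclideanSpace ℝ (Fin m) → ℝ) (α : ℝ≥0 → ℝ≥0)
    (x : EuclideanSpace ℝ (Fin n)) : Set (EuclideanSpace ℝ (Fin m)) :=
  {u ∈ U | h x u ≤ -(α ‖x‖₊ : ℝ)}

end Affine

end PSS

end

/-! Along (S), the derivative of `V` is the estimated derivative plus `δ`. At a boundary point of
`Ω` with `V = c`, the supremum condition gives `δ ≤ αq(‖x‖)`, so this derivative is at most `-α + αq
= -αp(‖x‖) < 0`, since `V = c > 0` forces `x ≠ 0`. Hence no trajectory leaves `Ω`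
(`forwardInvariant_sublevel`).

For stability, put `ψ = (α ∘ αup⁻¹)/2` and let `D` be the supremum of `|δ|`. If `V(x(t)) > ψ⁻¹(D)`,
then whenever `V` was at least `V(x(t))` on `(0, t]`, its derivative was below `-ψ(V(x(t)))`. Traced
backwards from `t`, this gives `V(x(t)) + t ψ(V(x(t))) ≤ V(x(0))` (`add_mul_le_of_forall_deriv_lt`).
Solving the corresponding equality for `V(x(t))` defines an explicit `KL∞` bound, `decayBound`, with
no comparison differential equation. Otherwise `V(x(t)) ≤ ψ⁻¹(D)`, which provides `γ`. -/

namespace PSS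

open Filter Set

/-! ### Comparison functions -/

section Comparison

namespace ClassKInfty

variable {f g : ℝ≥0 → ℝ≥0}

theorem surjective (hf : ClassKInfty f) : Function.Surjective f := fun y =>
  mem_range_of_exists_le_of_exists_ge hf.continuous ⟨0, hf.map_zero.trans_le zero_le⟩
    (hf.tendsto.eventually_ge_atTop y).exists

/-- A class `K∞` function as an order isomorphism of `[0, ∞)`. -/
noncomputable def orderIso (hf : ClassKInfty f) : ℝ≥0 ≃o ℝ≥0 :=
  hf.strictMono.orderIsoOfSurjective f hf.surjective

theorem of_orderIso (e : ℝ≥0 ≃o ℝ≥0) : ClassKInfty e where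
  continuous := e.continuous
  strictMono := e.strictMono
  map_zero := e.map_bot
  tendsto := e.tendsto_atTop

theorem comp (hf : ClassKInfty f) (hg : ClassKInfty g) : ClassKInfty fun r => f (g r) where
  continuous := hf.continuous.comp hg.continuous
  strictMono := hf.strictMono.comp hg.strictMono
  map_zero := by rw [hg.map_zero, hf.map_zero]
  tendsto := hf.tendsto.comp hg.tendsto

theorem const_mul (hf : ClassKInfty f) {a : ℝ≥0} (ha : 0 < a) : ClassKInfty fun r => a * f r where
  continuous := continuous_const.mul hf.continuous
  strictMono := fun _ _ h => mul_lt_mul_of_pos_left (hf.strictMono h) ha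
  map_zero := by rw [hf.map_zero, mul_zero]
  tendsto := hf.tendsto.const_mul_atTop ha

/-- The identity summand keeps the function in the class even at `t = 0`, so it can be inverted for
every `t`. -/
theorem id_add_const_mul (hf : ClassKInfty f) (t : ℝ≥0) : ClassKInfty fun w => w + t * f w where
  continuous := continuous_id.add (continuous_const.mul hf.continuous)
  strictMono := fun _ _ h =>
    add_lt_add_of_lt_of_le h (mul_le_mul_right (hf.strictMono.monotone h.le) t)
  map_zero := by rw [hf.map_zero, mul_zero, add_zero]
  tendsto := tendsto_atTop_mono (fun _ => le_self_add) tendsto_id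

theorem kInv_le_iff (hf : ClassKInfty f) {r : ℝ} {s : ℝ≥0} : kInv f r ≤ s ↔ r ≤ f s := by
  rw [← hf.strictMono.le_iff_le, kInv, Function.rightInverse_invFun hf.surjective,
    Real.toNNReal_le_iff_le_coe]

end ClassKInfty

/-- The solution `w` of the equation `w + t ψ(w) = r`. -/
noncomputable def decayBound {ψ : ℝ≥0 → ℝ≥0} (hψ : ClassKInfty ψ) (r t : ℝ≥0) : ℝ≥0 :=
  (hψ.id_add_const_mul t).orderIso.symm r

variable {ψ : ℝ≥0 → ℝ≥0} (hψ : ClassKInfty ψ)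

theorem lt_decayBound_iff {w r t : ℝ≥0} : w < decayBound hψ r t ↔ w + t * ψ w < r :=
  (hψ.id_add_const_mul t).orderIso.lt_symm_apply

theorem decayBound_lt_iff {w r t : ℝ≥0} : decayBound hψ r t < w ↔ r < w + t * ψ w :=
  (hψ.id_add_const_mul t).orderIso.symm_apply_lt

theorem le_decayBound_iff {w r t : ℝ≥0} : w ≤ decayBound hψ r t ↔ w + t * ψ w ≤ r :=
  (hψ.id_add_const_mul t).orderIso.le_symm_apply

/-- Comparing `w` with `decayBound hψ r t` amounts to comparing `w + t * ψ w` with `r`. The latter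
is continuous in `(r, t)`, which gives joint continuity; for `w > 0` the left side grows without
bound in `t`, which gives the limit `0`. -/
theorem classKLInfty_decayBound : ClassKLInfty (decayBound hψ) where
  continuous := by
    refine continuous_iff_continuousAt.2 fun p => tendsto_order.2 ⟨fun w hw => ?_, fun w hw => ?_⟩
    · have hc : Continuous fun q : ℝ≥0 × ℝ≥0 => w + q.2 * ψ w := by fun_prop
      filter_upwards [hc.continuousAt.eventually_lt continuous_fst.continuousAt
        ((lt_decayBound_iff hψ).1 hw)] with q hq
      exact (lt_decayBound_iff hψ).2 hq
    · have hc : Continuous fun q : ℝ≥0 × ℝ≥0 => w + q.2 * ψ w := by fun_prop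
      filter_upwards [continuous_fst.continuousAt.eventually_lt hc.continuousAt
        ((decayBound_lt_iff hψ).1 hw)] with q hq
      exact (decayBound_lt_iff hψ).2 hq
  classKInfty := fun t => ClassKInfty.of_orderIso (hψ.id_add_const_mul t).orderIso.symm
  antitone := fun r s t hst => by
    rw [le_decayBound_iff]
    refine le_trans ?_ ((le_decayBound_iff hψ (t := t)).1 le_rfl)
    gcongr
  tendsto := fun r => by
    refine tendsto_order.2 ⟨fun w hw => absurd hw not_lt_zero, fun w hw => ?_⟩
    have hψw : 0 < ψ w := hψ.map_zero ▸ hψ.strictMono hw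
    filter_upwards [(tendsto_id.atTop_mul_const hψw).eventually_gt_atTop r] with t ht
    exact (decayBound_lt_iff hψ).2 (lt_of_lt_of_le ht le_add_self)

theorem ClassKLInfty.comp_left {β : ℝ≥0 → ℝ≥0 → ℝ≥0} (hβ : ClassKLInfty β) {f g : ℝ≥0 → ℝ≥0}
    (hf : ClassKInfty f) (hg : ClassKInfty g) : ClassKLInfty fun r s => f (β (g r) s) where
  continuous := hf.continuous.comp <| hβ.continuous.comp <|
    (hg.continuous.comp continuous_fst).prodMk continuous_snd
  classKInfty := fun s => hf.comp ((hβ.classKInfty s).comp hg)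
  antitone := fun r _ _ h => hf.strictMono.monotone (hβ.antitone (g r) h)
  tendsto := fun r => by
    have h := (hf.continuous.tendsto 0).comp (hβ.tendsto (g r))
    rwa [hf.map_zero] at h

end Comparison

/-! ### Solutions -/

section Solutions

variable {T : EReal} {t : ℝ}

theorem mem_timeInterval_of_le (ht : t ∈ timeInterval T) {s : ℝ} (hs : 0 ≤ s) (hst : s ≤ t) :
    s ∈ timeInterval T :=
  ⟨hs, (EReal.coe_le_coe_iff.2 hst).trans_lt ht.2⟩

theorem Icc_subset_timeInterval (ht : t ∈ timeInterval T) : Icc 0 t ⊆ timeInterval T :=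
  fun _ hs => mem_timeInterval_of_le ht hs.1 hs.2

theorem eventually_lt_of_mem_timeInterval (ht : t ∈ timeInterval T) :
    ∀ᶠ s : ℝ in 𝓝 t, (s : EReal) < T :=
  continuous_coe_real_ereal.continuousAt.eventually_lt continuousAt_const ht.2

theorem timeInterval_mem_nhds (ht : t ∈ timeInterval T) (h0 : 0 < t) : timeInterval T ∈ 𝓝 t := by
  filter_upwards [eventually_lt_of_mem_timeInterval ht, eventually_ge_nhds h0] with s hs hs0
  exact ⟨hs0, hs⟩

theorem timeInterval_mem_nhdsGT (ht : t ∈ timeInterval T) : timeInterval T ∈ 𝓝[>] t := by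
  filter_upwards [nhdsWithin_le_nhds (eventually_lt_of_mem_timeInterval ht), self_mem_nhdsWithin]
    with s hs hs0
  exact ⟨ht.1.trans (le_of_lt hs0), hs⟩

theorem eventually_lt_of_hasDerivWithinAt_neg {v : ℝ → ℝ} {v' : ℝ}
    (h : HasDerivWithinAt v v' (Ioi t) t) (hv' : v' < 0) : ∀ᶠ s in 𝓝[>] t, v s < v t := by
  filter_upwards [((hasDerivWithinAt_iff_tendsto_slope' self_notMem_Ioi).1 h).eventually_lt_const
    hv', self_mem_nhdsWithin] with s hs hst
  rw [slope_def_field, div_neg_iff] at hs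
  have : 0 < s - t := sub_pos.2 hst
  rcases hs with hs | hs <;> linarith [hs.1, hs.2]

variable {E I : Type*} [NormedAddCommGroup E] [NormedSpace ℝ E]
  {X : Set E} {F : E → E} {x : ℝ → E} {V : E → ℝ} {c : ℝ}

theorem IsSolution.continuousOn (hx : IsSolution X F T x) : ContinuousOn x (timeInterval T) :=
  fun s hs => (hx s hs).2.continuousWithinAt

theorem IsSolution.hasDerivWithinAt_comp (hx : IsSolution X F T x)
    (hV : ∀ z ∈ X, DifferentiableAt ℝ V z) (ht : t ∈ timeInterval T) :
    HasDerivWithinAt (V ∘ x) (fderiv ℝ V (x t) (F (x t))) (timeInterval T) t :=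
  (hV _ (hx t ht).1).hasFDerivAt.comp_hasDerivWithinAt t (hx t ht).2

/-- A sublevel set of `V` is forward invariant if `V` strictly decreases along the vector field at
the boundary points on the level. -/
theorem forwardInvariant_sublevel {f : E → I → E} {k : E → I}
    (hV : ∀ z ∈ X, DifferentiableAt ℝ V z)
    (hneg : ∀ z ∈ relBoundary X (sublevel X V c), z ∈ sublevel X V c → V z = c →
      fderiv ℝ V z (f z (k z)) < 0) :
    ForwardInvariant X f k (sublevel X V c) := by
  intro T x hx h0 t ht
  have hsub := Icc_subset_timeInterval ht
  have hcont : ContinuousOn (V ∘ x) (timeInterval T) := fun s hs =>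
    (hx.hasDerivWithinAt_comp hV hs).continuousWithinAt
  have hclosed : IsClosed ({s | V (x s) ≤ c} ∩ Icc 0 t) := by
    rw [inter_comm]
    exact (hcont.mono hsub).preimage_isClosed_of_isClosed isClosed_Icc isClosed_Iic
  refine ⟨(hx t ht).1, hclosed.Icc_subset_of_forall_mem_nhdsWithin h0.2 ?_ ⟨ht.1, le_rfl⟩⟩
  rintro s ⟨hsc, hs⟩
  have hsT : s ∈ timeInterval T := hsub ⟨hs.1, hs.2.le⟩
  have hmem := timeInterval_mem_nhdsGT hsT
  have hsΩ : x s ∈ sublevel X V c := ⟨(hx s hsT).1, hsc⟩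
  -- A point with `V = c` may be interior to the sublevel set relative to `X`, for instance at a
  -- local maximum. There `hneg` gives nothing, but continuity of the `X`-valued trajectory
  -- suffices.
  by_cases hb : x s ∈ closure (X \ sublevel X V c)
  · rcases (show V (x s) ≤ c from hsc).lt_or_eq with hlt | heq
    · filter_upwards [((hcont s hsT).mono_of_mem_nhdsWithin hmem).eventually_lt_const hlt]
        with r hr using hr.le
    · filter_upwards [eventually_lt_of_hasDerivWithinAt_neg
        ((hx.hasDerivWithinAt_comp hV hsT).mono_of_mem_nhdsWithin hmem)
        (hneg _ ⟨⟨hsΩ.1, subset_closure hsΩ⟩, hb⟩ hsΩ heq)] with r hr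
      exact hr.le.trans heq.le
  · have hnhds : (closure (X \ sublevel X V c))ᶜ ∈ 𝓝 (x s) :=
      isClosed_closure.isOpen_compl.mem_nhds hb
    filter_upwards [((hx.continuousOn s hsT).mono_of_mem_nhdsWithin hmem) hnhds, hmem]
      with r hr hrT
    by_contra hrc
    exact hr (subset_closure ⟨(hx r hrT).1, fun h => hrc h.2⟩)

/-- If `v` decreases at a rate larger than `ε` whenever `v ≥ v(t)`, then it has decreased by at
least `ε t` at time `t`. -/
theorem add_mul_le_of_forall_deriv_lt {v v' : ℝ → ℝ} {ε : ℝ} (hε : 0 ≤ ε) (ht : 0 ≤ t)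
    (hcont : ContinuousOn v (Icc 0 t)) (hv : ∀ s ∈ Ioc 0 t, HasDerivAt v (v' s) s)
    (hdecr : ∀ s ∈ Ioc 0 t, v t ≤ v s → v' s < -ε) : v t + t * ε ≤ v 0 := by
  have hsub : ∀ s ∈ Ico 0 t, t - s ∈ Ioc 0 t := fun s hs =>
    ⟨sub_pos.2 hs.2, sub_le_self _ hs.1⟩
  -- After time reversal, contact with the line means `v (t - s) = v t + s * ε ≥ v t`, exactly where
  -- `hdecr` applies.
  have key := image_le_of_deriv_right_lt_deriv_boundary (a := 0) (b := t)
    (f := fun s => -v (t - s)) (f' := fun s => v' (t - s))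
    (B := fun s => -v t - s * ε) (B' := fun _ => -ε)
    ((hcont.comp (by fun_prop) fun s hs => ⟨sub_nonneg.2 hs.2, sub_le_self _ hs.1⟩).neg)
    (fun s hs => by
      have := ((hv _ (hsub s hs)).comp_const_sub t s).neg.hasDerivWithinAt (s := Ici s)
      rwa [neg_neg] at this)
    (by simp)
    (fun s => by simpa using ((hasDerivAt_id s).mul_const ε).const_sub (-v t))
    (fun s hs heq => hdecr _ (hsub s hs) (by
      have := mul_nonneg hs.1 hε
      linarith))
    (right_mem_Icc.2 ht)
  simp only [sub_self] at key
  linarith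

end Solutions

/-! ### Projection to state stability -/

section Stability

variable {E I : Type*} [NormedAddCommGroup E] [NormedSpace ℝ E]
  {X Ω : Set E} {f : E → I → E} {k : E → I} {V : E → ℝ} {h : E → I → ℝ} {lo up α : ℝ≥0 → ℝ≥0}

/-- A Lyapunov function `V` whose modelled derivative is at most `-α(‖x‖)` on a forward invariant
set `Ω` makes the system projection to state stable on `Ω` with respect to `V`. -/
theorem isPSSOn_of_lyapunov (hΩX : Ω ⊆ X) (hV : ∀ z ∈ X, ContDiffAt ℝ 1 V z)
    (hlo : ClassKInfty lo) (hup : ClassKInfty up) (hα : ClassKInfty α)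
    (hbounds : ∀ z ∈ Ω, (lo ‖z‖₊ : ℝ) ≤ V z ∧ V z ≤ up ‖z‖₊)
    (hdecr : ∀ z ∈ Ω, h z (k z) ≤ -(α ‖z‖₊ : ℝ)) (hinv : ForwardInvariant X f k Ω) :
    IsPSSOn X f k V h Ω := by
  have hnorm : ∀ z ∈ Ω, (‖V z‖₊ : ℝ) = V z := fun z hz => by
    rw [coe_nnnorm, Real.norm_of_nonneg ((NNReal.coe_nonneg _).trans (hbounds z hz).1)]
  have hnn : ∀ z ∈ Ω, lo ‖z‖₊ ≤ ‖V z‖₊ ∧ ‖V z‖₊ ≤ up ‖z‖₊ := fun z hz => by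
    rw [← NNReal.coe_le_coe, ← NNReal.coe_le_coe, hnorm z hz]
    exact hbounds z hz
  refine ⟨⟨fun z hz => hV z (hΩX hz), lo, up, hlo, hup, hnn⟩, ?_⟩
  have hloInv : ClassKInfty hlo.orderIso.symm := .of_orderIso _
  have hψ : ClassKInfty fun w => α (hup.orderIso.symm w) := hα.comp (.of_orderIso _)
  have hψ2 : ClassKInfty fun w => (2⁻¹ : ℝ≥0) * α (hup.orderIso.symm w) := hψ.const_mul (by simp)
  have hψ2Inv : ClassKInfty hψ2.orderIso.symm := .of_orderIso _
  -- `β r t = lo⁻¹ (decayBound hψ2 (up r) t)` and `γ = lo⁻¹ ∘ ψ2⁻¹`, with `ψ2 = (α ∘ up⁻¹)/2`.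
  refine ⟨_, _, (classKLInfty_decayBound hψ2).comp_left hloInv hup, hloInv.comp hψ2Inv, ?_⟩
  intro T x hx h0 hbdd t ht
  have hxΩ := hinv T x hx h0
  set D := ⨆ τ : timeInterval T, ‖projDisturbance V f h (x τ) (k (x τ))‖₊
  have hD : ∀ s ∈ timeInterval T, projDisturbance V f h (x s) (k (x s)) ≤ D := fun s hs =>
    (le_abs_self _).trans (NNReal.coe_le_coe.2 (le_ciSup hbdd ⟨s, hs⟩))
  have hdiff : ∀ z ∈ X, DifferentiableAt ℝ V z := fun z hz =>
    (hV z hz).differentiableAt one_ne_zero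
  have hstate : ‖x t‖₊ ≤ hlo.orderIso.symm ‖V (x t)‖₊ :=
    hlo.orderIso.le_symm_apply.2 (hnn _ (hxΩ t ht)).1
  rcases le_or_gt ‖V (x t)‖₊ (hψ2.orderIso.symm D) with hle | hgt
  · exact (hstate.trans (hloInv.strictMono.monotone hle)).trans le_add_self
  refine (hstate.trans (hloInv.strictMono.monotone ?_)).trans le_self_add
  refine ((le_decayBound_iff hψ2).2 ?_).trans
    (((classKLInfty_decayBound hψ2).classKInfty _).strictMono.monotone (hnn _ h0).2)
  -- Half of the guaranteed decay `2ε` absorbs the disturbance, as `D < ε`; the other half is the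
  -- decay rate.
  set ε : ℝ≥0 := 2⁻¹ * α (hup.orderIso.symm ‖V (x t)‖₊) with hεdef
  have hDε : D < ε := hψ2.orderIso.symm_apply_lt.1 hgt
  have key := add_mul_le_of_forall_deriv_lt (v := V ∘ x)
    (v' := fun s => fderiv ℝ V (x s) (f (x s) (k (x s)))) (NNReal.coe_nonneg ε) ht.1
    (fun s hs => ((hx.hasDerivWithinAt_comp hdiff
      (Icc_subset_timeInterval ht hs)).continuousWithinAt).mono (Icc_subset_timeInterval ht))
    (fun s hs => (hx.hasDerivWithinAt_comp hdiff (mem_timeInterval_of_le ht hs.1.le hs.2)).hasDerivAt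
      (timeInterval_mem_nhds (mem_timeInterval_of_le ht hs.1.le hs.2) hs.1))
    (fun s hs hle => by
      have hsT := mem_timeInterval_of_le ht hs.1.le hs.2
      have hsΩ := hxΩ s hsT
      have hα' : α (hup.orderIso.symm ‖V (x t)‖₊) ≤ α ‖x s‖₊ := by
        refine hα.strictMono.monotone (hup.orderIso.symm_apply_le.2 (le_trans ?_ (hnn _ hsΩ).2))
        rw [← NNReal.coe_le_coe, hnorm _ hsΩ, hnorm _ (hxΩ t ht)]
        exact hle
      have h1 : (α (hup.orderIso.symm ‖V (x t)‖₊) : ℝ) ≤ α ‖x s‖₊ := hα'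
      have h2 : (D : ℝ) < ε := hDε
      have h3 : (ε : ℝ) = 2⁻¹ * α (hup.orderIso.symm ‖V (x t)‖₊) := by simp [hεdef]
      have h4 := hD s hsT
      have h5 := hdecr _ hsΩ
      rw [projDisturbance] at h4
      linarith)
  rw [← NNReal.coe_le_coe, NNReal.coe_add, NNReal.coe_mul, Real.coe_toNNReal _ ht.1,
    hnorm _ h0, hnorm _ (hxΩ t ht)]
  exact key

end Stability

/-! ### Affine control systems -/

section Affine

variable {n m : ℕ}

/-- The nominal terms cancel and the adjoint moves `A x` onto the gradient. This identifies the
abstract disturbance with the pair that `Δ x` contains. -/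
theorem projDisturbance_uncertainDyn
    (fhat : EuclideanSpace ℝ (Fin n) → EuclideanSpace ℝ (Fin n))
    (ghat : EuclideanSpace ℝ (Fin n) → EuclideanSpace ℝ (Fin m) →L[ℝ] EuclideanSpace ℝ (Fin n))
    (A : EuclideanSpace ℝ (Fin n) → EuclideanSpace ℝ (Fin m) →L[ℝ] EuclideanSpace ℝ (Fin n))
    (b : EuclideanSpace ℝ (Fin n) → EuclideanSpace ℝ (Fin n))
    (V : EuclideanSpace ℝ (Fin n) → ℝ)
    (ahat : EuclideanSpace ℝ (Fin n) → EuclideanSpace ℝ (Fin m))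
    (bhat : EuclideanSpace ℝ (Fin n) → ℝ)
    (x : EuclideanSpace ℝ (Fin n)) (u : EuclideanSpace ℝ (Fin m)) :
    projDisturbance V (uncertainDyn fhat ghat A b) (estDeriv fhat ghat V ahat bhat) x u =
      ⟪residualA A V ahat x, u⟫ + residualB b V bhat x := by
  have hgrad : ∀ y, fderiv ℝ V x y = ⟪y, gradient V x⟫ := fun y => by
    rw [real_inner_comm, gradient, InnerProductSpace.toDual_symm_apply]
  rw [projDisturbance, estDeriv, residualA, residualB, uncertainDyn, hgrad, inner_add_left,
    inner_add_left, inner_sub_left, ContinuousLinearMap.adjoint_inner_left,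
    real_inner_comm (A x u)]
  ring

end Affine

end PSS

theorem theorem2 {n m : ℕ}
    (X C : Set (EuclideanSpace ℝ (Fin n))) (U : Set (EuclideanSpace ℝ (Fin m)))
    (hCX : C ⊆ X) (h0 : (0 : EuclideanSpace ℝ (Fin n)) ∈ C)
    (fhat : EuclideanSpace ℝ (Fin n) → EuclideanSpace ℝ (Fin n))
    (ghat : EuclideanSpace ℝ (Fin n) → EuclideanSpace ℝ (Fin m) →L[ℝ] EuclideanSpace ℝ (Fin n))
    (A : EuclideanSpace ℝ (Fin n) → EuclideanSpace ℝ (Fin m) →L[ℝ] EuclideanSpace ℝ (Fin n))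
    (b : EuclideanSpace ℝ (Fin n) → EuclideanSpace ℝ (Fin n))
    (V : EuclideanSpace ℝ (Fin n) → ℝ) (αlo αup α : ℝ≥0 → ℝ≥0)
    (hV : PSS.IsCLFOn X C U (PSS.nominalDyn fhat ghat) V αlo αup α)
    (ahat : EuclideanSpace ℝ (Fin n) → EuclideanSpace ℝ (Fin m))
    (bhat : EuclideanSpace ℝ (Fin n) → ℝ)
    (hAss : ∀ x ∈ C, (⨅ u ∈ U, (PSS.estDeriv fhat ghat V ahat bhat x u : EReal)) ≤
      ((-(α ‖x‖₊ : ℝ) : ℝ) : EReal))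
    (Δ : EuclideanSpace ℝ (Fin n) → Set (EuclideanSpace ℝ (Fin m) × ℝ))
    (hΔ : PSS.IsUncertaintyFunction X (PSS.residualA A V ahat) (PSS.residualB b V bhat) Δ)
    (k : EuclideanSpace ℝ (Fin n) → EuclideanSpace ℝ (Fin m))
    (hkU : ∀ x ∈ X, k x ∈ U)
    (hk : ∀ x ∈ C, k x ∈ PSS.admissibleInputs U (PSS.estDeriv fhat ghat V ahat bhat) α x)
    (αp αq : ℝ≥0 → ℝ≥0) (hαp : PSS.ClassKInfty αp) (hαq : PSS.ClassKInfty αq)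
    (hα : ∀ s, αp s + αq s = α s)
    (c : ℝ) (hc : 0 < c) (hΩC : PSS.sublevel X V c ⊆ C)
    (hbd : ∀ x ∈ PSS.relBoundary X (PSS.sublevel X V c),
      (⨆ p ∈ Δ x, (PSS.kInv αq (⟪p.1, k x⟫ + p.2) : ℝ≥0∞)) ≤ (‖x‖₊ : ℝ≥0∞)) :
    PSS.ForwardInvariant X (PSS.uncertainDyn fhat ghat A b) k (PSS.sublevel X V c) ∧
      PSS.IsPSSOn X (PSS.uncertainDyn fhat ghat A b) k V
        (PSS.estDeriv fhat ghat V ahat bhat) (PSS.sublevel X V c) := by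

  have hΩ : ∀ x ∈ PSS.sublevel X V c, PSS.estDeriv fhat ghat V ahat bhat x (k x) ≤
      -(α ‖x‖₊ : ℝ) := fun x hx => (hk x (hΩC hx)).2
  have hinv : PSS.ForwardInvariant X (PSS.uncertainDyn fhat ghat A b) k
      (PSS.sublevel X V c) := by
    refine PSS.forwardInvariant_sublevel
      (fun x hx => (hV.contDiff x hx).differentiableAt one_ne_zero) fun x hxb hxΩ hxc => ?_
    -- The true residual pair is one competitor in the supremum over `Δ x`.
    have hδ : ⟪PSS.residualA A V ahat x, k x⟫ + PSS.residualB b V bhat x ≤ (αq ‖x‖₊ : ℝ) :=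
      hαq.kInv_le_iff.1 <| ENNReal.coe_le_coe.1 <|
        (le_iSup₂ (f := fun (p : EuclideanSpace ℝ (Fin m) × ℝ) (_ : p ∈ Δ x) =>
          (PSS.kInv αq (⟪p.1, k x⟫ + p.2) : ℝ≥0∞)) _ (hΔ x hxΩ.1).2).trans (hbd x hxb)
    rw [← PSS.projDisturbance_uncertainDyn fhat ghat, PSS.projDisturbance] at hδ
    have hx0 : 0 < ‖x‖₊ := by
      refine pos_iff_ne_zero.2 fun h0 => hc.not_ge ?_
      have := (hV.le x (hΩC hxΩ)).2
      rwa [h0, hV.up_classKInfty.map_zero, hxc] at this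
    have hpos : (0 : ℝ) < αp ‖x‖₊ :=
      NNReal.coe_pos.2 (hαp.map_zero ▸ hαp.strictMono hx0)
    have hsum : (αp ‖x‖₊ : ℝ) + αq ‖x‖₊ = α ‖x‖₊ := by exact_mod_cast hα ‖x‖₊
    linarith [hΩ x hxΩ]
  exact ⟨hinv, PSS.isPSSOn_of_lyapunov (fun _ hx => hx.1) hV.contDiff hV.lo_classKInfty
    hV.up_classKInfty hV.classKInfty (fun x hx => hV.le x (hΩC hx)) hΩ hinv⟩
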